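/- All topological groups are Hausdorff. For topological abelian groups $G,H$, an \emph{extension} of $G$ by $H$ is a short exact sequence $0\to H\xrightarrow{\imath}X\xrightarrow{\pi}G\to 0$ of topological abelian groups in which the homomorphisms $\imath$ and $\pi$ are continuous and open onto their images. Two extensions $0\to H\xrightarrow{\imath}X\xrightarrow{\pi}G\to 0$ and $0\to H\xrightarrow{\imath'}X'\xrightarrow{\pi'}G\to 0$ are \emph{equivalent} if there is a continuous homomorphism $T:X\to X'$ with $T\circ\imath=\imath'$ and $\pi'\circ T=\pi$. Let $\mathrm{Ext}(G,H)$ be the abelian group of equivalence classes of extensions of $G$ by $H$ under the Baer sum, where $E_1+E_2$ is obtained from the product extension $0\to H\times H\to X_1\times X_2\to G\times G\to 0$ by pulling back along the diagonal $G\to G\times G$ and then pushing out along the addition $H\times H\to H$. A topological space is \emph{\v{C}ech-complete} if it is Tychonoff and is a $G_\delta$ subset of its Stone--\v{C}ech compactification. Theorem. Let $G$ be a topological abelian group, let $D$ be a dense subgroup of $G$ with the subspace topology, and let $H$ be a \v{C}ech-complete topological abelian group. Then there is an isomorphism of abelian groups $\mathrm{Ext}(G,H)\cong\mathrm{Ext}(D,H)$.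 -/

import Mathlib

open Topology

universe u v

/-- A topological space is Čech-complete if it is a Tychonoff space that is a `G_δ` subset of its
Stone-Čech compactification. -/
class CechCompleteSpace (X : Type u) [TopologicalSpace X] : Prop where
  t35Space : T35Space X
  isGδ_range : IsGδ (Set.range (stoneCechUnit : X → StoneCech X))

/-- An extension of topological abelian groups `0 → H → X → G → 0`: a short exact sequence whose
maps are continuous homomorphisms that are open onto their images. For the injective map `ι` this
says that `ι` is a topological embedding, for the surjective map `π` that it is an open quotient
map. As shown in `TopAddExtension.t2Space`, the group `X` is Hausdorff if `G` and `H` are. Since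
`X` has the cardinality of `H × G`, the universe of `X` is no restriction. -/
structure TopAddExtension (G : Type u) (H : Type v) [AddCommGroup G] [TopologicalSpace G]
    [AddCommGroup H] [TopologicalSpace H] where
  /-- the middle group -/
  X : Type (max u v)
  [addCommGroup : AddCommGroup X]
  [topologicalSpace : TopologicalSpace X]
  [isTopologicalAddGroup : IsTopologicalAddGroup X]
  /-- the inclusion -/
  ι : H →ₜ+ X
  /-- the projection -/
  π : X →ₜ+ G
  isEmbedding : IsEmbedding ι
  isOpenQuotientMap : IsOpenQuotientMap π
  exact : Function.Exact ι π

namespace TopAddExtension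

attribute [instance] addCommGroup topologicalSpace isTopologicalAddGroup

section Basic

variable {G : Type u} {H : Type v} [AddCommGroup G] [TopologicalSpace G]
  [AddCommGroup H] [TopologicalSpace H]

theorem π_ι (E : TopAddExtension G H) (h : H) : E.π (E.ι h) = 0 :=
  (E.exact _).2 ⟨h, rfl⟩

theorem t2Space (E : TopAddExtension G H) [T2Space G] [T2Space H] : T2Space E.X := by
  have hc : IsClosed (E.π ⁻¹' {0}) := isClosed_singleton.preimage E.isOpenQuotientMap.continuous
  have hr : Set.range E.ι = E.π ⁻¹' {0} := by
    ext x
    exact (E.exact x).symm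
  have hι : IsClosedEmbedding E.ι := ⟨E.isEmbedding, hr ▸ hc⟩
  have h0 : IsClosed ({0} : Set E.X) := by
    have := hι.isClosedMap {0} isClosed_singleton
    simpa using this
  have : T1Space E.X := IsTopologicalAddGroup.t1Space _ h0
  infer_instance

/-- Two extensions of `G` by `H` are equivalent if there is a continuous homomorphism between the
middle groups that is compatible with the inclusions of `H` and the projections to `G`. -/
def Equivalent (E E' : TopAddExtension G H) : Prop :=
  ∃ T : E.X →ₜ+ E'.X, (∀ h, T (E.ι h) = E'.ι h) ∧ ∀ x, E'.π (T x) = E.π x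

theorem Equivalent.refl (E : TopAddExtension G H) : Equivalent E E :=
  ⟨ContinuousAddMonoidHom.id _, fun _ => rfl, fun _ => rfl⟩

theorem Equivalent.trans {E E' E'' : TopAddExtension G H} (h : Equivalent E E')
    (h' : Equivalent E' E'') : Equivalent E E'' := by
  obtain ⟨T, h1, h2⟩ := h
  obtain ⟨T', h1', h2'⟩ := h'
  exact ⟨T'.comp T, fun x => by simp [h1, h1'], fun x => by simp [h2, h2']⟩

theorem Equivalent.symm {E E' : TopAddExtension G H} (h : Equivalent E E') :
    Equivalent E' E := by
  obtain ⟨T, h1, h2⟩ := h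
  have hinj : Function.Injective T := by
    rw [injective_iff_map_eq_zero]
    intro x hx
    obtain ⟨k, rfl⟩ := (E.exact x).1 (by rw [← h2, hx, map_zero])
    rw [h1, map_eq_zero_iff _ E'.isEmbedding.injective] at hx
    rw [hx, map_zero]
  have hsurj : Function.Surjective T := by
    intro x'
    obtain ⟨x, hx⟩ := E.isOpenQuotientMap.surjective (E'.π x')
    obtain ⟨k, hk⟩ := (E'.exact (x' - T x)).1 (by rw [map_sub, h2, hx, sub_self])
    exact ⟨x + E.ι k, by rw [map_add, h1, hk]; abel⟩
  let e : E.X ≃+ E'.X := AddEquiv.ofBijective T.toAddMonoidHom ⟨hinj, hsurj⟩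
  have he : ∀ x, e x = T x := fun _ => rfl
  have hcont : Continuous e.symm := by
    refine continuous_of_continuousAt_zero e.symm ?_
    rw [ContinuousAt, map_zero]
    intro U hU
    obtain ⟨V, hV, hVU⟩ := exists_nhds_zero_half hU
    have hVι : E.ι ⁻¹' V ∈ 𝓝 (0 : H) :=
      E.ι.continuous_toFun.continuousAt.preimage_mem_nhds (by simpa using hV)
    rw [E'.isEmbedding.nhds_eq_comap, map_zero] at hVι
    obtain ⟨W, hW, hWV⟩ := Filter.mem_comap.1 hVι
    obtain ⟨W', hW', hWW⟩ := exists_nhds_half_neg hW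
    have hTW : T ⁻¹' W' ∈ 𝓝 (0 : E.X) :=
      T.continuous_toFun.continuousAt.preimage_mem_nhds (by simpa using hW')
    have hπ : E.π '' (V ∩ T ⁻¹' W') ∈ 𝓝 (0 : G) := by
      have := E.isOpenQuotientMap.isOpenMap.image_mem_nhds (Filter.inter_mem hV hTW)
      simpa using this
    have hπ' : E'.π ⁻¹' (E.π '' (V ∩ T ⁻¹' W')) ∈ 𝓝 (0 : E'.X) :=
      E'.π.continuous_toFun.continuousAt.preimage_mem_nhds (by simpa using hπ)
    change e.symm ⁻¹' U ∈ 𝓝 0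
    filter_upwards [Filter.inter_mem hW' hπ'] with x' hx'
    obtain ⟨hxW, v, ⟨hvV, hvW⟩, hv⟩ := hx'
    obtain ⟨k, hk⟩ := (E'.exact (x' - T v)).1 (by rw [map_sub, h2, hv, sub_self])
    have hkV : E.ι k ∈ V := hWV (by
      change E'.ι k ∈ W
      rw [hk]
      exact hWW _ hxW _ hvW)
    have : e.symm x' = v + E.ι k := by
      rw [AddEquiv.symm_apply_eq, he, map_add, h1, hk]
      abel
    change e.symm x' ∈ U
    rw [this]
    exact hVU _ hvV _ hkV
  refine ⟨⟨e.symm.toAddMonoidHom, hcont⟩, fun k => ?_, fun x => ?_⟩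
  · change e.symm (E'.ι k) = E.ι k
    rw [AddEquiv.symm_apply_eq, he, h1]
  · change E.π (e.symm x) = E'.π x
    rw [← h2, ← he, e.apply_symm_apply]

instance setoid (G : Type u) (H : Type v) [AddCommGroup G] [TopologicalSpace G]
    [AddCommGroup H] [TopologicalSpace H] : Setoid (TopAddExtension G H) where
  r := Equivalent
  iseqv := ⟨Equivalent.refl, Equivalent.symm, Equivalent.trans⟩

/-- The trivial extension `0 → H → H × G → G → 0`. -/
def trivial (G : Type u) (H : Type v) [AddCommGroup G] [TopologicalSpace G]
    [AddCommGroup H] [TopologicalSpace H] [IsTopologicalAddGroup G] [IsTopologicalAddGroup H] :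
    TopAddExtension G H where
  X := H × G
  ι := ContinuousAddMonoidHom.inl H G
  π := ContinuousAddMonoidHom.snd H G
  isEmbedding := isEmbedding_prodMkLeft 0
  isOpenQuotientMap := ⟨Prod.snd_surjective, continuous_snd, isOpenMap_snd⟩
  exact := by
    rintro ⟨h, g⟩
    constructor
    · rintro rfl
      exact ⟨h, rfl⟩
    · rintro ⟨k, hk⟩
      exact (congrArg Prod.snd hk).symm

/-- The extension obtained from `E` by changing the sign of the inclusion. -/
def neg [IsTopologicalAddGroup H] (E : TopAddExtension G H) : TopAddExtension G H where
  X := E.X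
  ι := E.ι.comp (ContinuousAddMonoidHom.neg H)
  π := E.π
  isEmbedding := E.isEmbedding.comp (Homeomorph.neg H).isEmbedding
  isOpenQuotientMap := E.isOpenQuotientMap
  exact := by
    intro x
    rw [E.exact x]
    constructor
    · rintro ⟨h, rfl⟩
      exact ⟨-h, by simp⟩
    · rintro ⟨h, rfl⟩
      exact ⟨-h, rfl⟩

end Basic

section Prod

variable {G₁ G₂ : Type u} {H₁ H₂ : Type v}
  [AddCommGroup G₁] [TopologicalSpace G₁] [AddCommGroup H₁] [TopologicalSpace H₁]
  [AddCommGroup G₂] [TopologicalSpace G₂] [AddCommGroup H₂] [TopologicalSpace H₂]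

/-- The product extension `0 → H₁ × H₂ → X₁ × X₂ → G₁ × G₂ → 0`. -/
def prod (E₁ : TopAddExtension G₁ H₁) (E₂ : TopAddExtension G₂ H₂) :
    TopAddExtension (G₁ × G₂) (H₁ × H₂) where
  X := E₁.X × E₂.X
  ι := E₁.ι.prodMap E₂.ι
  π := E₁.π.prodMap E₂.π
  isEmbedding := E₁.isEmbedding.prodMap E₂.isEmbedding
  isOpenQuotientMap := E₁.isOpenQuotientMap.prodMap E₂.isOpenQuotientMap
  exact := by
    rintro ⟨x, y⟩
    constructor
    · intro h
      obtain ⟨a, ha⟩ := (E₁.exact x).1 (congrArg Prod.fst h)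
      obtain ⟨b, hb⟩ := (E₂.exact y).1 (congrArg Prod.snd h)
      exact ⟨(a, b), Prod.ext ha hb⟩
    · rintro ⟨⟨a, b⟩, hab⟩
      exact Prod.ext ((E₁.exact x).2 ⟨a, congrArg Prod.fst hab⟩)
        ((E₂.exact y).2 ⟨b, congrArg Prod.snd hab⟩)

end Prod

section Pullback

variable {G G' : Type u} {H : Type v}
  [AddCommGroup G] [TopologicalSpace G] [AddCommGroup H] [TopologicalSpace H]
  [AddCommGroup G'] [TopologicalSpace G']

/-- The pull-back `{(x, y) ∈ X × G' | π x = t y}` of `π : X → G` and `t : G' → G`. -/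
def pullbackGroup (E : TopAddExtension G H) (t : G' →ₜ+ G) : AddSubgroup (E.X × G') where
  carrier := {p | E.π p.1 = t p.2}
  add_mem' := by
    intro a b ha hb
    simp only [Set.mem_ofPred_eq] at *
    simp [ha, hb]
  zero_mem' := by simp
  neg_mem' := by
    intro a ha
    simp only [Set.mem_ofPred_eq] at *
    simp [ha]

theorem ι_mem_pullbackGroup (E : TopAddExtension G H) (t : G' →ₜ+ G) (h : H) :
    (E.ι h, (0 : G')) ∈ E.pullbackGroup t := by
  change E.π (E.ι h) = t 0
  rw [E.π_ι, map_zero]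

/-- The inclusion `h ↦ (ι h, 0)` of `H` into the pull-back. -/
def pullbackι (E : TopAddExtension G H) (t : G' →ₜ+ G) : H →ₜ+ E.pullbackGroup t where
  toFun h := ⟨(E.ι h, 0), E.ι_mem_pullbackGroup t h⟩
  map_zero' := by ext <;> simp
  map_add' a b := by ext <;> simp
  continuous_toFun := (E.ι.continuous_toFun.prodMk continuous_const).subtype_mk _

/-- The projection `(x, y) ↦ y` of the pull-back to `G'`. -/
def pullbackπ (E : TopAddExtension G H) (t : G' →ₜ+ G) : E.pullbackGroup t →ₜ+ G' where
  toFun p := p.1.2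
  map_zero' := rfl
  map_add' _ _ := rfl
  continuous_toFun := continuous_snd.comp continuous_subtype_val

/-- The pull-back extension `E t` of `E` along a continuous homomorphism `t : G' → G`. -/
def pullback [IsTopologicalAddGroup G'] (E : TopAddExtension G H) (t : G' →ₜ+ G) :
    TopAddExtension G' H where
  X := E.pullbackGroup t
  ι := E.pullbackι t
  π := E.pullbackπ t
  isEmbedding := by
    refine IsEmbedding.of_comp (E.pullbackι t).continuous_toFun
      (continuous_fst.comp continuous_subtype_val) ?_
    exact E.isEmbedding
  isOpenQuotientMap := by
    refine ⟨fun y => ?_, continuous_snd.comp continuous_subtype_val, ?_⟩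
    · obtain ⟨x, hx⟩ := E.isOpenQuotientMap.surjective (t y)
      exact ⟨⟨(x, y), hx⟩, rfl⟩
    · rw [isOpenMap_iff_nhds_le]
      rintro ⟨⟨x, y⟩, hxy⟩ S hS
      rw [Filter.mem_map, nhds_subtype_eq_comap, Filter.mem_comap] at hS
      obtain ⟨W, hW, hWS⟩ := hS
      rw [nhds_prod_eq, Filter.mem_prod_iff] at hW
      obtain ⟨A, hA, B, hB, hAB⟩ := hW
      have h1 : E.π '' A ∈ 𝓝 (t y) := by
        have := E.isOpenQuotientMap.isOpenMap.image_mem_nhds hA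
        rwa [show E.π x = t y from hxy] at this
      have h2 : t ⁻¹' (E.π '' A) ∈ 𝓝 y := t.continuous_toFun.continuousAt.preimage_mem_nhds h1
      change S ∈ 𝓝 y
      filter_upwards [Filter.inter_mem h2 hB] with z hz
      obtain ⟨⟨a, ha, haz⟩, hzB⟩ := hz
      exact hWS (show (⟨(a, z), haz⟩ : E.pullbackGroup t) ∈ _ from hAB ⟨ha, hzB⟩)
  exact := by
    rintro ⟨⟨x, y⟩, hxy⟩
    constructor
    · intro h
      change y = 0 at h
      subst h
      obtain ⟨k, hk⟩ := (E.exact x).1 (by rw [show E.π x = t 0 from hxy, map_zero])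
      exact ⟨k, Subtype.ext (Prod.ext hk rfl)⟩
    · rintro ⟨k, hk⟩
      exact (congrArg (E.pullbackπ t) hk).symm

end Pullback

section Pushout

variable {G : Type u} {H H' : Type v}
  [AddCommGroup G] [TopologicalSpace G] [AddCommGroup H] [TopologicalSpace H]
  [AddCommGroup H'] [TopologicalSpace H']

/-- The subgroup `{(t h, -ι h) | h ∈ H}` of `H' × X`. -/
def pushoutSubgroup (E : TopAddExtension G H) (t : H →ₜ+ H') : AddSubgroup (H' × E.X) :=
  (t.toAddMonoidHom.prod (-E.ι.toAddMonoidHom)).range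

theorem mem_pushoutSubgroup (E : TopAddExtension G H) (t : H →ₜ+ H') (p : H' × E.X) :
    p ∈ E.pushoutSubgroup t ↔ ∃ h, t h = p.1 ∧ -E.ι h = p.2 := by
  constructor
  · rintro ⟨h, rfl⟩
    exact ⟨h, rfl, rfl⟩
  · rintro ⟨h, h1, h2⟩
    exact ⟨h, Prod.ext h1 h2⟩

/-- The push-out extension `t E` of `E` along a continuous homomorphism `t : H → H'`; its middle
group is the push-out `(H' × X) / {(t h, -ι h) | h ∈ H}` of `t` and `ι`. -/
def pushout [IsTopologicalAddGroup H'] (E : TopAddExtension G H) (t : H →ₜ+ H') :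
    TopAddExtension G H' where
  X := (H' × E.X) ⧸ E.pushoutSubgroup t
  ι :=
    { toFun := fun y => QuotientAddGroup.mk (y, 0)
      map_zero' := rfl
      map_add' := fun a b => by
        rw [← QuotientAddGroup.mk_add, Prod.mk_add_mk, add_zero]
      continuous_toFun := QuotientAddGroup.continuous_mk.comp (by fun_prop) }
  π :=
    { toAddMonoidHom := QuotientAddGroup.lift (E.pushoutSubgroup t)
        (E.π.toAddMonoidHom.comp (AddMonoidHom.snd H' E.X)) (by
          rintro p hp
          obtain ⟨h, -, h2⟩ := (E.mem_pushoutSubgroup t p).1 hp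
          change E.π p.2 = 0
          rw [← h2, map_neg, E.π_ι, neg_zero])
      continuous_toFun := by
        refine QuotientAddGroup.isOpenQuotientMap_mk.continuous_comp_iff.1 ?_
        exact E.π.continuous_toFun.comp continuous_snd }
  isEmbedding := by
    let f : H' →+ (H' × E.X) ⧸ E.pushoutSubgroup t :=
      (QuotientAddGroup.mk' (E.pushoutSubgroup t)).comp (AddMonoidHom.inl H' E.X)
    change IsEmbedding f
    have hf : ∀ y, f y = QuotientAddGroup.mk (y, 0) := fun _ => rfl
    have hfc : Continuous f := QuotientAddGroup.continuous_mk.comp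
      (Continuous.prodMk continuous_id continuous_const)
    refine ⟨?_, ?_⟩
    · refine (IsTopologicalAddGroup.isInducing_iff_nhds_zero (f := f)).2 ?_
      refine le_antisymm ?_ ?_
      · rw [← Filter.map_le_iff_le_comap]
        have := hfc.tendsto 0
        rwa [map_zero] at this
      · intro U hU
        obtain ⟨V, hV, hVU⟩ := exists_nhds_zero_half hU
        have ht : t ⁻¹' V ∈ 𝓝 (0 : H) :=
          t.continuous_toFun.continuousAt.preimage_mem_nhds (by simpa using hV)
        rw [E.isEmbedding.nhds_eq_comap, map_zero] at ht
        obtain ⟨W, hW, hWV⟩ := Filter.mem_comap.1 ht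
        have hN : V ×ˢ W ∈ 𝓝 (0 : H' × E.X) := prod_mem_nhds hV hW
        have := (QuotientAddGroup.isOpenQuotientMap_mk
          (N := E.pushoutSubgroup t)).isOpenMap.image_mem_nhds hN
        refine Filter.mem_comap.2 ⟨_, this, ?_⟩
        rintro y ⟨⟨a, b⟩, ⟨ha, hb⟩, hab⟩
        rw [hf, QuotientAddGroup.eq, mem_pushoutSubgroup] at hab
        obtain ⟨h, h1, h2⟩ := hab
        simp only [Prod.neg_mk, Prod.mk_add_mk, add_zero] at h1 h2
        have hh : t h ∈ V := hWV (by
          change E.ι h ∈ W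
          rw [neg_inj.1 h2]
          exact hb)
        have : y = a + t h := by rw [h1]; abel
        rw [this]
        exact hVU _ ha _ hh
    · rw [injective_iff_map_eq_zero]
      intro y hy
      rw [hf, QuotientAddGroup.eq_zero_iff, mem_pushoutSubgroup] at hy
      obtain ⟨h, h1, h2⟩ := hy
      rw [neg_eq_zero, map_eq_zero_iff _ E.isEmbedding.injective] at h2
      rw [← show t h = y from h1, h2, map_zero]
  isOpenQuotientMap := by
    refine (QuotientAddGroup.isOpenQuotientMap_mk (N := E.pushoutSubgroup t)).of_comp_iff.1 ?_
    exact E.isOpenQuotientMap.comp ⟨Prod.snd_surjective, continuous_snd, isOpenMap_snd⟩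
  exact := by
    intro q
    obtain ⟨⟨y, x⟩, rfl⟩ := QuotientAddGroup.mk_surjective q
    change E.π x = 0 ↔ _
    constructor
    · intro hx
      obtain ⟨h, rfl⟩ := (E.exact x).1 hx
      refine ⟨y + t h, ?_⟩
      refine QuotientAddGroup.eq.2 ((E.mem_pushoutSubgroup t _).2 ⟨-h, ?_, ?_⟩) <;> simp
    · rintro ⟨z, hz⟩
      obtain ⟨h, -, h2⟩ := (E.mem_pushoutSubgroup t _).1 (QuotientAddGroup.eq.1 hz)
      have : -E.ι h = x := by simpa using h2
      rw [← this, map_neg, E.π_ι, neg_zero]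

/-- A continuous homomorphism from `X` to the middle group of an extension `F`, compatible with
`t` and with the projections, makes `F` equivalent to the push-out extension along `t`. -/
theorem pushout_equivalent [IsTopologicalAddGroup H'] (E : TopAddExtension G H) (t : H →ₜ+ H')
    (F : TopAddExtension G H') (S : E.X →ₜ+ F.X) (h1 : ∀ h, S (E.ι h) = F.ι (t h))
    (h2 : ∀ x, F.π (S x) = E.π x) : Equivalent (E.pushout t) F := by
  let f : (H' × E.X) →+ F.X := F.ι.toAddMonoidHom.coprod S.toAddMonoidHom
  have hf : ∀ p, f p = F.ι p.1 + S p.2 := fun _ => rfl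
  have hfc : Continuous f :=
    (F.ι.continuous_toFun.comp continuous_fst).add (S.continuous_toFun.comp continuous_snd)
  refine ⟨⟨QuotientAddGroup.lift (E.pushoutSubgroup t) f ?_, ?_⟩, fun y => ?_, fun q => ?_⟩
  · intro p hp
    obtain ⟨h, ha, hb⟩ := (E.mem_pushoutSubgroup t p).1 hp
    change f p = 0
    rw [hf, ← ha, ← hb, map_neg, h1, add_neg_cancel]
  · exact QuotientAddGroup.isOpenQuotientMap_mk.continuous_comp_iff.1 hfc
  · change f (y, 0) = F.ι y
    simp [hf]
  · obtain ⟨⟨y, x⟩, rfl⟩ := QuotientAddGroup.mk_surjective q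
    change F.π (f (y, x)) = E.π x
    simp [hf, h2, F.π_ι]

theorem equivalent_of_common [IsTopologicalAddGroup H'] (E : TopAddExtension G H) (t : H →ₜ+ H')
    (F F' : TopAddExtension G H') (S : E.X →ₜ+ F.X) (h1 : ∀ h, S (E.ι h) = F.ι (t h))
    (h2 : ∀ x, F.π (S x) = E.π x) (S' : E.X →ₜ+ F'.X) (h1' : ∀ h, S' (E.ι h) = F'.ι (t h))
    (h2' : ∀ x, F'.π (S' x) = E.π x) : Equivalent F F' :=
  (pushout_equivalent E t F S h1 h2).symm.trans (pushout_equivalent E t F' S' h1' h2')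

end Pushout

section Baer

variable {G : Type u} {H : Type v} [AddCommGroup G] [TopologicalSpace G]
  [AddCommGroup H] [TopologicalSpace H] [IsTopologicalAddGroup G] [IsTopologicalAddGroup H]

/-- The pull-back of the product extension along the diagonal of `G`. -/
abbrev diagProd (E₁ E₂ : TopAddExtension G H) : TopAddExtension G (H × H) :=
  (E₁.prod E₂).pullback (ContinuousAddMonoidHom.diag G)

/-- The Baer sum `∇ ((E₁ × E₂) Δ)`, with `Δ` the diagonal of `G` and `∇` the addition of `H`. -/
def baerSum (E₁ E₂ : TopAddExtension G H) : TopAddExtension G H :=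
  (E₁.diagProd E₂).pushout (ContinuousAddMonoidHom.add H)

theorem diagProd_mem (E₁ E₂ : TopAddExtension G H) (p : (E₁.diagProd E₂).X) :
    E₁.π p.1.1.1 = p.1.2 ∧ E₂.π p.1.1.2 = p.1.2 :=
  ⟨congrArg Prod.fst p.2, congrArg Prod.snd p.2⟩

/-- The canonical map from the pull-back to the middle group of the Baer sum. -/
def toBaerSum (E₁ E₂ : TopAddExtension G H) : (E₁.diagProd E₂).X →ₜ+ (E₁.baerSum E₂).X where
  toAddMonoidHom := (QuotientAddGroup.mk' ((E₁.diagProd E₂).pushoutSubgroup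
    (ContinuousAddMonoidHom.add H))).comp (AddMonoidHom.inr H (E₁.diagProd E₂).X)
  continuous_toFun := QuotientAddGroup.continuous_mk.comp
    (Continuous.prodMk continuous_const continuous_id)

theorem toBaerSum_ι (E₁ E₂ : TopAddExtension G H) (h : H × H) :
    toBaerSum E₁ E₂ ((E₁.diagProd E₂).ι h) = (E₁.baerSum E₂).ι (h.1 + h.2) := by
  refine QuotientAddGroup.eq.2 ((mem_pushoutSubgroup _ _ _).2 ⟨h, ?_, ?_⟩) <;> simp

theorem π_toBaerSum (E₁ E₂ : TopAddExtension G H) (p : (E₁.diagProd E₂).X) :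
    (E₁.baerSum E₂).π (toBaerSum E₁ E₂ p) = p.1.2 := rfl

/-- Mapping two homomorphisms that agree after projection to `G` into the Baer sum. -/
def liftBaerSum {A : Type*} [AddCommGroup A] [TopologicalSpace A] (E₁ E₂ : TopAddExtension G H)
    (f₁ : A →ₜ+ E₁.X) (f₂ : A →ₜ+ E₂.X) (hf : ∀ a, E₂.π (f₂ a) = E₁.π (f₁ a)) :
    A →ₜ+ (E₁.baerSum E₂).X :=
  (toBaerSum E₁ E₂).comp
    { toFun := fun a => ⟨((f₁ a, f₂ a), E₁.π (f₁ a)), Prod.ext rfl (hf a)⟩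
      map_zero' := by
        apply Subtype.ext
        simp only [map_zero]
        rfl
      map_add' := fun a b => by
        apply Subtype.ext
        simp only [map_add]
        rfl
      continuous_toFun := by
        refine Continuous.subtype_mk ?_ _
        exact (f₁.continuous_toFun.prodMk f₂.continuous_toFun).prodMk
          (E₁.π.continuous_toFun.comp f₁.continuous_toFun) }

theorem liftBaerSum_ι {A : Type*} [AddCommGroup A] [TopologicalSpace A]
    (E₁ E₂ : TopAddExtension G H) (f₁ : A →ₜ+ E₁.X) (f₂ : A →ₜ+ E₂.X)
    (hf : ∀ a, E₂.π (f₂ a) = E₁.π (f₁ a)) (a : A) (h₁ h₂ : H) (e₁ : f₁ a = E₁.ι h₁)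
    (e₂ : f₂ a = E₂.ι h₂) : liftBaerSum E₁ E₂ f₁ f₂ hf a = (E₁.baerSum E₂).ι (h₁ + h₂) := by
  rw [← toBaerSum_ι E₁ E₂ (h₁, h₂)]
  refine congrArg (toBaerSum E₁ E₂) (Subtype.ext (Prod.ext (Prod.ext e₁ e₂) ?_))
  change E₁.π (f₁ a) = 0
  rw [e₁, E₁.π_ι]

theorem π_liftBaerSum {A : Type*} [AddCommGroup A] [TopologicalSpace A]
    (E₁ E₂ : TopAddExtension G H) (f₁ : A →ₜ+ E₁.X) (f₂ : A →ₜ+ E₂.X)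
    (hf : ∀ a, E₂.π (f₂ a) = E₁.π (f₁ a)) (a : A) :
    (E₁.baerSum E₂).π (liftBaerSum E₁ E₂ f₁ f₂ hf a) = E₁.π (f₁ a) := rfl

/-- The first projection of the pull-back. -/
def diagFst (E₁ E₂ : TopAddExtension G H) : (E₁.diagProd E₂).X →ₜ+ E₁.X where
  toFun p := p.1.1.1
  map_zero' := rfl
  map_add' _ _ := rfl
  continuous_toFun := continuous_fst.comp (continuous_fst.comp continuous_subtype_val)

/-- The second projection of the pull-back. -/
def diagSnd (E₁ E₂ : TopAddExtension G H) : (E₁.diagProd E₂).X →ₜ+ E₂.X where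
  toFun p := p.1.1.2
  map_zero' := rfl
  map_add' _ _ := rfl
  continuous_toFun := continuous_snd.comp (continuous_fst.comp continuous_subtype_val)

theorem π_diagFst (E₁ E₂ : TopAddExtension G H) (p : (E₁.diagProd E₂).X) :
    E₁.π (diagFst E₁ E₂ p) = (E₁.diagProd E₂).π p := (diagProd_mem E₁ E₂ p).1

theorem π_diagSnd (E₁ E₂ : TopAddExtension G H) (p : (E₁.diagProd E₂).X) :
    E₂.π (diagSnd E₁ E₂ p) = (E₁.diagProd E₂).π p := (diagProd_mem E₁ E₂ p).2

theorem baerSum_equivalent (E₁ E₂ F : TopAddExtension G H) (S : (E₁.diagProd E₂).X →ₜ+ F.X)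
    (h1 : ∀ h, S ((E₁.diagProd E₂).ι h) = F.ι (h.1 + h.2))
    (h2 : ∀ p, F.π (S p) = (E₁.diagProd E₂).π p) : Equivalent (E₁.baerSum E₂) F :=
  pushout_equivalent _ (ContinuousAddMonoidHom.add H) F S h1 h2

theorem baerSum_congr {E₁ E₂ F₁ F₂ : TopAddExtension G H} (h₁ : Equivalent E₁ F₁)
    (h₂ : Equivalent E₂ F₂) : Equivalent (E₁.baerSum E₂) (F₁.baerSum F₂) := by
  obtain ⟨T₁, a₁, b₁⟩ := h₁
  obtain ⟨T₂, a₂, b₂⟩ := h₂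
  refine baerSum_equivalent _ _ _ (liftBaerSum F₁ F₂ (T₁.comp (diagFst E₁ E₂))
    (T₂.comp (diagSnd E₁ E₂)) fun p => ?_) (fun h => ?_) fun p => ?_
  · exact (b₂ _).trans ((π_diagSnd E₁ E₂ p).trans
      ((π_diagFst E₁ E₂ p).symm.trans (b₁ _).symm))
  · exact liftBaerSum_ι _ _ _ _ _ _ _ _ (a₁ h.1) (a₂ h.2)
  · exact (b₁ _).trans (π_diagFst E₁ E₂ p)

theorem baerSum_comm (E₁ E₂ : TopAddExtension G H) :
    Equivalent (E₁.baerSum E₂) (E₂.baerSum E₁) := by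
  refine baerSum_equivalent _ _ _ (liftBaerSum E₂ E₁ (diagSnd E₁ E₂) (diagFst E₁ E₂)
    fun p => ?_) (fun h => ?_) fun p => ?_
  · rw [π_diagFst, π_diagSnd]
  · rw [add_comm]
    exact liftBaerSum_ι _ _ _ _ _ _ _ _ rfl rfl
  · rw [π_liftBaerSum, π_diagSnd]

theorem baerSum_trivial (E : TopAddExtension G H) :
    Equivalent (E.baerSum (trivial G H)) E := by
  refine baerSum_equivalent _ _ _ (diagFst E (trivial G H) + E.ι.comp
    ((ContinuousAddMonoidHom.fst H G).comp (diagSnd E (trivial G H)))) (fun h => ?_) fun p => ?_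
  · rw [map_add]
    rfl
  · rw [ContinuousAddMonoidHom.add_apply, map_add, π_diagFst]
    change _ + E.π (E.ι _) = _
    rw [E.π_ι, add_zero]

theorem baerSum_neg (E : TopAddExtension G H) :
    Equivalent (E.neg.baerSum E) (trivial G H) := by
  let f : (E.neg.diagProd E).X →ₜ+ E.X := diagFst E.neg E
  let d : (E.neg.diagProd E).X →ₜ+ E.X :=
    diagSnd E.neg E + (ContinuousAddMonoidHom.neg E.X).comp f
  have hd : ∀ p, d p = diagSnd E.neg E p - f p := fun p => by
    rw [sub_eq_add_neg]
    rfl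
  have hk : ∀ p, ∃ k, E.ι k = d p := fun p => (E.exact _).1 (by
    rw [hd, map_sub, π_diagSnd, show E.π (f p) = _ from π_diagFst E.neg E p,
      sub_self])
  choose k hk using hk
  have hinj := E.isEmbedding.injective
  let κ : (E.neg.diagProd E).X →ₜ+ H :=
    { toFun := k
      map_zero' := hinj (by rw [hk, map_zero, map_zero])
      map_add' := fun a b => hinj (by rw [hk, map_add, map_add, hk, hk])
      continuous_toFun := by
        rw [E.isEmbedding.continuous_iff]
        exact d.continuous_toFun.congr fun p => (hk p).symm }
  refine baerSum_equivalent _ _ _ (κ.prod (E.neg.diagProd E).π) (fun h => ?_) fun p => rfl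
  refine Prod.ext ?_ (π_ι _ _)
  change k _ = h.1 + h.2
  apply hinj
  rw [hk, hd]
  change E.ι h.2 - E.ι (-h.1) = _
  simp [add_comm]

theorem baerSum_assoc (E₁ E₂ E₃ : TopAddExtension G H) :
    Equivalent ((E₁.baerSum E₂).baerSum E₃) (E₁.baerSum (E₂.baerSum E₃)) := by
  let P := (E₁.prod (E₂.prod E₃)).pullback
    ((ContinuousAddMonoidHom.id G).prod (ContinuousAddMonoidHom.diag G))
  have hP : ∀ p : P.X, E₁.π p.1.1.1 = p.1.2 ∧ E₂.π p.1.1.2.1 = p.1.2 ∧ E₃.π p.1.1.2.2 = p.1.2 :=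
    fun p => ⟨congrArg Prod.fst p.2, congrArg (fun q => q.2.1) p.2,
      congrArg (fun q => q.2.2) p.2⟩
  let t : H × H × H →ₜ+ H := (ContinuousAddMonoidHom.add H).comp
    ((ContinuousAddMonoidHom.id H).prodMap (ContinuousAddMonoidHom.add H))
  have ht : ∀ h, t h = h.1 + (h.2.1 + h.2.2) := fun _ => rfl
  let q : P.X →ₜ+ E₁.X × E₂.X × E₃.X :=
    { toFun := fun p => p.1.1
      map_zero' := rfl
      map_add' := fun _ _ => rfl
      continuous_toFun := continuous_fst.comp continuous_subtype_val }
  let q₁ : P.X →ₜ+ E₁.X := (ContinuousAddMonoidHom.fst _ _).comp q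
  let q₂ : P.X →ₜ+ E₂.X :=
    ((ContinuousAddMonoidHom.fst _ _).comp (ContinuousAddMonoidHom.snd _ _)).comp q
  let q₃ : P.X →ₜ+ E₃.X :=
    ((ContinuousAddMonoidHom.snd _ _).comp (ContinuousAddMonoidHom.snd _ _)).comp q
  have c₁₂ : ∀ p, E₂.π (q₂ p) = E₁.π (q₁ p) := fun p => (hP p).2.1.trans (hP p).1.symm
  have c₂₃ : ∀ p, E₃.π (q₃ p) = E₂.π (q₂ p) := fun p => (hP p).2.2.trans (hP p).2.1.symm
  have c₁₃ : ∀ p, E₃.π (q₃ p) = (E₁.baerSum E₂).π (liftBaerSum E₁ E₂ q₁ q₂ c₁₂ p) :=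
    fun p => (c₂₃ p).trans (c₁₂ p)
  have c₁₂' : ∀ p, (E₂.baerSum E₃).π (liftBaerSum E₂ E₃ q₂ q₃ c₂₃ p) = E₁.π (q₁ p) := c₁₂
  refine equivalent_of_common P t _ _
    (liftBaerSum _ _ (liftBaerSum E₁ E₂ q₁ q₂ c₁₂) q₃ c₁₃) (fun h => ?_) (fun p => (hP p).1)
    (liftBaerSum _ _ q₁ (liftBaerSum E₂ E₃ q₂ q₃ c₂₃) c₁₂') (fun h => ?_) (fun p => (hP p).1)
  · rw [ht, ← add_assoc]
    exact liftBaerSum_ι _ _ _ _ _ _ _ _ (liftBaerSum_ι _ _ _ _ _ _ _ _ rfl rfl) rfl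
  · rw [ht]
    exact liftBaerSum_ι _ _ _ _ _ _ _ _ rfl (liftBaerSum_ι _ _ _ _ _ _ _ _ rfl rfl)

theorem neg_congr {E F : TopAddExtension G H} (h : Equivalent E F) :
    Equivalent E.neg F.neg := by
  obtain ⟨T, a, b⟩ := h
  exact ⟨T, fun h => a (-h), b⟩

end Baer

end TopAddExtension

/-- `Ext(G, H)`: the equivalence classes of extensions of topological abelian groups
`0 → H → X → G → 0`. -/
def TopExt (G : Type u) (H : Type v) [AddCommGroup G] [TopologicalSpace G]
    [AddCommGroup H] [TopologicalSpace H] : Type (max (u + 1) (v + 1)) :=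
  Quotient (TopAddExtension.setoid G H)

namespace TopExt

variable {G : Type u} {H : Type v} [AddCommGroup G] [TopologicalSpace G]
  [AddCommGroup H] [TopologicalSpace H] [IsTopologicalAddGroup G] [IsTopologicalAddGroup H]

/-- Addition in `Ext(G, H)` is the Baer sum. -/
instance : Add (TopExt G H) where
  add := Quotient.map₂ TopAddExtension.baerSum
    fun _ _ h₁ _ _ h₂ => TopAddExtension.baerSum_congr h₁ h₂

instance : Zero (TopExt G H) where
  zero := Quotient.mk _ (TopAddExtension.trivial G H)

instance : Neg (TopExt G H) where
  neg := Quotient.map TopAddExtension.neg fun _ _ h => TopAddExtension.neg_congr h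

/-- `Ext(G, H)` is an abelian group under the Baer sum. -/
instance : AddCommGroup (TopExt G H) where
  add_assoc := by
    rintro ⟨E₁⟩ ⟨E₂⟩ ⟨E₃⟩
    exact Quotient.sound (TopAddExtension.baerSum_assoc E₁ E₂ E₃)
  add_comm := by
    rintro ⟨E₁⟩ ⟨E₂⟩
    exact Quotient.sound (TopAddExtension.baerSum_comm E₁ E₂)
  zero_add := by
    rintro ⟨E⟩
    exact Quotient.sound ((TopAddExtension.baerSum_comm _ E).trans
      (TopAddExtension.baerSum_trivial E))
  add_zero := by
    rintro ⟨E⟩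
    exact Quotient.sound (TopAddExtension.baerSum_trivial E)
  neg_add_cancel := by
    rintro ⟨E⟩
    exact Quotient.sound (TopAddExtension.baerSum_neg E)
  nsmul := nsmulRec
  zsmul := zsmulRec

end TopExt

/-!
A Čech-complete group `H` is complete, being a dense `G_δ` subgroup of its completion: any coset of
`H` there would be a second dense `G_δ` set, and the two meet. For an extension `X` of `G` by `H`,
neighbourhoods of zero in `H` shrink to a compact set along a countable sequence. This lets a Cauchy
filter on `G` be lifted to sets of `X` whose differences are contained in a compact set up to an
arbitrarily small error, and any ultrafilter containing these sets is Cauchy. Hence the completion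
of `X` surjects onto that of `G`, and it is again an extension by `H`. Since it is complete, it
receives every homomorphism defined on a dense subgroup; together with the universal property of
pullbacks this makes the restriction of extensions to a dense subgroup bijective.
-/

open Filter Set UniformSpace

theorem dense_preimage_of_isDenseInducing {X Z : Type*} [TopologicalSpace X] [TopologicalSpace Z]
    {i : X → Z} (hi : IsDenseInducing i) {S : Set Z} (hS : Dense S) (hSo : IsOpen S) :
    Dense (i ⁻¹' S) := by
  refine dense_iff_inter_open.2 fun V hV hne => ?_
  obtain ⟨W, hW, rfl⟩ := hi.isInducing.isOpen_iff.1 hV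
  obtain ⟨x, hx⟩ := hne
  obtain ⟨y, hy⟩ := hi.dense.exists_mem_open (hW.inter hSo) (hS.inter_open_nonempty W hW ⟨_, hx⟩)
  exact ⟨y, hy⟩

theorem baireSpace_of_isDenseInducing {X Z : Type*} [TopologicalSpace X] [TopologicalSpace Z]
    [BaireSpace X] {i : X → Z} (hi : IsDenseInducing i) : BaireSpace Z where
  baire_property S hSo hS := by
    have hpre : Dense (⋂ n, i ⁻¹' S n) := dense_iInter_of_isOpen
      (fun n => (hSo n).preimage hi.continuous) fun n =>
        dense_preimage_of_isDenseInducing hi (hS n) (hSo n)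
    refine (hi.dense.dense_image hi.continuous hpre).mono ?_
    rw [← preimage_iInter]
    exact image_preimage_subset i _

namespace CechCompleteSpace

section Topology

variable {X : Type*} [TopologicalSpace X]

theorem eq_stoneCechUnit_of_stoneCechExtend_eq [T35Space X] {C : Type*} [TopologicalSpace C]
    [CompactSpace C] [T2Space C] {j : X → C} (hj : IsEmbedding j) {x : X} {y : StoneCech X}
    (h : stoneCechExtend hj.continuous y = j x) : y = stoneCechUnit x := by
  have : (comap stoneCechUnit (𝓝 y)).NeBot :=
    isDenseInducing_stoneCechUnit.comap_nhds_neBot y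
  have hy : Tendsto stoneCechUnit (comap stoneCechUnit (𝓝 y)) (𝓝 y) := tendsto_comap
  have hx : comap stoneCechUnit (𝓝 y) ≤ 𝓝 x := by
    rw [hj.nhds_eq_comap, ← tendsto_iff_comap, ← h]
    simpa [Function.comp_def] using ((continuous_stoneCechExtend hj.continuous).tendsto y).comp hy
  exact tendsto_nhds_unique hy ((continuous_stoneCechUnit.tendsto x).mono_left hx)

variable [CechCompleteSpace X]

theorem isGδ_range_of_compactSpace {C : Type*} [TopologicalSpace C] [CompactSpace C]
    [T2Space C] {j : X → C} (hj : IsDenseEmbedding j) : IsGδ (range j) := by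
  have := t35Space (X := X)
  obtain ⟨O, hO, hr⟩ := (isGδ_range (X := X)).eq_iInter_nat
  set c := stoneCechExtend hj.continuous
  have hc : Continuous c := continuous_stoneCechExtend hj.continuous
  have hcj : ∀ x, c (stoneCechUnit x) = j x := stoneCechExtend_stoneCechUnit hj.continuous
  have hsurj : Function.Surjective c := by
    have hdense : DenseRange c := hj.dense.mono (range_subset_iff.2 fun x => ⟨_, hcj x⟩)
    exact range_eq_univ.1 ((isCompact_range hc).isClosed.closure_eq ▸ hdense.closure_eq)
  have hrange : range j = ⋂ n, (c '' (O n)ᶜ)ᶜ := by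
    rw [← compl_iUnion, ← image_iUnion, ← compl_iInter, ← hr]
    refine Subset.antisymm ?_ fun z hz => ?_
    · rintro _ ⟨x, rfl⟩ ⟨y, hy, hyx⟩
      exact hy ⟨x, (eq_stoneCechUnit_of_stoneCechExtend_eq hj.isEmbedding hyx).symm⟩
    · obtain ⟨y, rfl⟩ := hsurj z
      obtain ⟨x, rfl⟩ := not_not.1 fun hy => hz (mem_image_of_mem c hy)
      exact ⟨x, (hcj x).symm⟩
  rw [hrange]
  exact .iInter_of_isOpen fun n =>
    ((hO n).isClosed_compl.isCompact.image hc).isClosed.isOpen_compl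

theorem isGδ_range_of_isDenseEmbedding {Z : Type*} [TopologicalSpace Z] [T35Space Z] {j : X → Z}
    (hj : IsDenseEmbedding j) : IsGδ (range j) := by
  have hjβ : IsDenseEmbedding (stoneCechUnit ∘ j) := {
    toIsInducing := isInducing_stoneCechUnit.comp hj.isInducing
    dense := denseRange_stoneCechUnit.comp hj.dense continuous_stoneCechUnit
    injective := isEmbedding_stoneCechUnit.injective.comp hj.injective }
  have := (isGδ_range_of_compactSpace hjβ).preimage (continuous_stoneCechUnit (α := Z))
  rwa [range_comp, preimage_image_eq _ isEmbedding_stoneCechUnit.injective] at this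

theorem baireSpace : BaireSpace X := by
  have := t35Space (X := X)
  have : BaireSpace (range (stoneCechUnit : X → StoneCech X)) :=
    (isGδ_range (X := X)).baireSpace_of_dense denseRange_stoneCechUnit
  exact isEmbedding_stoneCechUnit.toHomeomorph.symm.baireSpace

theorem exists_isCompact_nhds_seq (p : X) :
    ∃ K : Set X, IsCompact K ∧ ∃ B : ℕ → Set X, (∀ n, B n ∈ 𝓝 p) ∧
      ∀ V ∈ 𝓝ˢ K, ∃ n, B n ⊆ V := by
  have := t35Space (X := X)
  obtain ⟨O, hO, hr⟩ := (isGδ_range (X := X)).eq_iInter_nat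
  have hp : ∀ n, O n ∈ 𝓝 (stoneCechUnit p) := fun n =>
    (hO n).mem_nhds (mem_iInter.1 (hr ▸ mem_range_self p) n)
  choose C hC hCc hCO using fun n => exists_mem_nhds_isClosed_subset (hp n)
  let C' : ℕ → Set (StoneCech X) := fun n => ⋂ i ≤ n, C i
  have hC' : ∀ n, C' n ∈ 𝓝 (stoneCechUnit p) := fun n =>
    (biInter_mem (finite_le_nat n)).2 fun i _ => hC i
  have hC'c : ∀ n, IsClosed (C' n) := fun n => isClosed_biInter fun i _ => hCc i
  have hanti : Antitone C' := fun m n hmn => biInter_subset_biInter_left fun i hi => le_trans hi hmn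
  have hsub : ⋂ n, C' n ⊆ range (stoneCechUnit : X → StoneCech X) := by
    rw [hr]
    exact iInter_mono fun n x hx => hCO n (mem_iInter₂.1 hx n le_rfl)
  refine ⟨stoneCechUnit ⁻¹' ⋂ n, C' n, ?_, fun n => stoneCechUnit ⁻¹' C' n,
    fun n => continuous_stoneCechUnit.continuousAt.preimage_mem_nhds (hC' n), fun V hKV => ?_⟩
  · exact (isInducing_stoneCechUnit.isCompact_preimage_iff hsub).2
      (isClosed_iInter hC'c).isCompact
  · rw [isInducing_stoneCechUnit.nhdsSet_eq_comap, image_preimage_eq_of_subset hsub] at hKV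
    obtain ⟨V', hV', hV'V⟩ := mem_comap.1 hKV
    obtain ⟨n, hn⟩ := exists_subset_nhds_of_isCompact' hanti.directed_ge
      (fun n => (hC'c n).isCompact) hC'c (U := V') fun x hx => nhds_le_nhdsSet hx hV'
    exact ⟨n, (preimage_mono hn).trans hV'V⟩

end Topology

theorem completeSpace {H : Type*} [AddCommGroup H] [UniformSpace H] [IsUniformAddGroup H]
    [CechCompleteSpace H] : CompleteSpace H := by
  have := t35Space (X := H)
  have := baireSpace (X := H)
  have : T35Space (Completion H) := ⟨⟩
  have hdense : IsDenseEmbedding ((↑) : H → Completion H) := Completion.isDenseEmbedding_coe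
  have := baireSpace_of_isDenseInducing hdense.isDenseInducing
  have hGδ : IsGδ (range ((↑) : H → Completion H)) := isGδ_range_of_isDenseEmbedding hdense
  have hsurj : Function.Surjective ((↑) : H → Completion H) := fun z => by
    have hcoset : Dense ((z - ·) ⁻¹' range ((↑) : H → Completion H)) :=
      hdense.dense.preimage (Homeomorph.subLeft z).isOpenMap
    obtain ⟨_, ⟨h, rfl⟩, k, hk⟩ := (hdense.dense.inter_of_Gδ hGδ
      (hGδ.preimage (f := (z - ·)) (by fun_prop)) hcoset).nonempty
    exact ⟨k + h, by rw [Completion.coe_add, hk, sub_add_cancel]⟩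
  exact ((Completion.isUniformInducing_coe H).completeSpace_congr hsurj).2 inferInstance

end CechCompleteSpace

open scoped Pointwise

section Lift

theorem exists_nhds_zero_seq_add_subset {X : Type*} [AddGroup X] [TopologicalSpace X]
    [IsTopologicalAddGroup X] {A : ℕ → Set X} (hA : ∀ n, A n ∈ 𝓝 0) :
    ∃ U : ℕ → Set X, (∀ n, U n ∈ 𝓝 0) ∧ (∀ n, U n ⊆ A n) ∧ (∀ n, -U n = U n) ∧
      ∀ n, U (n + 1) + U (n + 1) ⊆ U n := by
  choose! half half_mem _ neg_half half_add using
    fun (B : Set X) (hB : B ∈ 𝓝 0) => exists_closed_nhds_zero_neg_eq_add_subset hB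
  have half_subset : ∀ B ∈ 𝓝 (0 : X), half B ⊆ B := fun B hB =>
    (subset_add_left _ (mem_of_mem_nhds (half_mem B hB))).trans (half_add B hB)
  let P : ℕ → Set X := fun n => Nat.rec (A 0) (fun n S => half S ∩ A (n + 1)) n
  have hP : ∀ n, P n ∈ 𝓝 0 := by
    intro n
    induction n with
    | zero => exact hA 0
    | succ n ih => exact inter_mem (half_mem _ ih) (hA _)
  have hPA : ∀ n, P n ⊆ A n
    | 0 => subset_rfl
    | _ + 1 => inter_subset_right
  refine ⟨fun n => half (P n), fun n => half_mem _ (hP n),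
    fun n => (half_subset _ (hP n)).trans (hPA n), fun n => neg_half _ (hP n), fun n => ?_⟩
  exact (half_add _ (hP (n + 1))).trans inter_subset_left

theorem exists_isCompact_range_inter_subset {H X : Type*} [AddGroup H] [TopologicalSpace H]
    [CechCompleteSpace H] [AddGroup X] [TopologicalSpace X] [IsTopologicalAddGroup X] {ι : H →+ X}
    (hι : IsInducing ι) :
    ∃ K : Set X, IsCompact K ∧ ∃ A : ℕ → Set X, (∀ n, A n ∈ 𝓝 0) ∧
      ∀ W ∈ 𝓝 (0 : X), ∃ n, range ι ∩ A n ⊆ K + W := by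
  obtain ⟨K, hK, B, hB, hKB⟩ := CechCompleteSpace.exists_isCompact_nhds_seq (0 : H)
  choose A hA hAB using fun n => mem_comap.1 (map_zero ι ▸ hι.nhds_eq_comap 0 ▸ hB n)
  refine ⟨ι '' K, hK.image hι.continuous, A, hA, fun W hW => ?_⟩
  have hKW : ι '' K + W ∈ 𝓝ˢ (ι '' K) := mem_nhdsSet_iff_forall.2 fun k hk =>
    mem_of_superset (by simpa using vadd_mem_nhds_vadd k hW) (vadd_set_subset_add hk)
  obtain ⟨n, hn⟩ := hKB _ (hι.continuous.tendsto_nhdsSet (mapsTo_image ι K) hKW)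
  refine ⟨n, ?_⟩
  rintro _ ⟨⟨h, rfl⟩, hh⟩
  exact hn (hAB n hh)

variable {X G : Type*} [AddCommGroup X] [AddCommGroup G] [UniformSpace G] [IsUniformAddGroup G]
  {π : X →+ G}

theorem cauchy_iff_exists_sub_subset {𝓕 : Filter G} :
    Cauchy 𝓕 ↔ 𝓕.NeBot ∧ ∀ N ∈ 𝓝 (0 : G), ∃ F ∈ 𝓕, F - F ⊆ N := by
  rw [IsUniformAddGroup.cauchy_iff_tendsto]
  refine and_congr_right fun _ => forall₂_congr fun N _ => ?_
  simp only [mem_map, mem_prod_same_iff, sub_subset_iff, prod_subset_iff, mem_preimage]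

theorem exists_seq_sub_mem_map_mem [TopologicalSpace X] (hπ : IsOpenQuotientMap π)
    {𝓕 : Filter G} (h𝓕 : Cauchy 𝓕) {U : ℕ → Set X} (hU : ∀ n, U n ∈ 𝓝 0) :
    ∃ (F : ℕ → Set G) (x : ℕ → X), (∀ n, F n ∈ 𝓕) ∧ (∀ n, F n - F n ⊆ π '' U n) ∧
      (∀ n, π (x n) ∈ F n) ∧ ∀ n, x (n + 1) - x n ∈ U n := by
  obtain ⟨hne, h𝓕⟩ := cauchy_iff_exists_sub_subset.1 h𝓕
  choose F hF hFU using fun n => h𝓕 (π '' U n) (by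
    simpa using hπ.isOpenMap.image_mem_nhds (hU n))
  let F' : ℕ → Set G := fun n => ⋂ i ≤ n, F i
  have hF' : ∀ n, F' n ∈ 𝓕 := fun n => (biInter_mem (finite_le_nat n)).2 fun i _ => hF i
  have hF'anti : ∀ n, F' (n + 1) ⊆ F' n := fun n =>
    biInter_subset_biInter_left fun i hi => le_trans hi n.le_succ
  have hF'F : ∀ n, F' n ⊆ F n := fun n => biInter_subset_of_mem (le_refl n)
  have hF'U : ∀ n, F' n - F' n ⊆ π '' U n := fun n =>
    (sub_subset_sub (hF'F n) (hF'F n)).trans (hFU n)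
  choose y hy using fun n => hne.nonempty_of_mem (hF' n)
  choose u hu hπu using fun n => hF'U n (sub_mem_sub (hF'anti n (hy (n + 1))) (hy n))
  obtain ⟨x₀, hx₀⟩ := hπ.surjective (y 0)
  refine ⟨F', fun n => x₀ + ∑ i ∈ Finset.range n, u i, hF', hF'U, fun n => ?_, fun n => ?_⟩
  · simp only [map_add, map_sum, hπu, hx₀, Finset.sum_range_sub, add_sub_cancel, hy]
  · simpa only [Finset.sum_range_succ, add_sub_add_left_eq_sub, add_sub_cancel_left] using hu n

theorem exists_antitone_seq_inter_preimage_nonempty [TopologicalSpace X]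
    [IsTopologicalAddGroup X] (hπ : IsOpenQuotientMap π) {𝓕 : Filter G} (h𝓕 : Cauchy 𝓕)
    {A : ℕ → Set X} (hA : ∀ n, A n ∈ 𝓝 0) :
    ∃ S : ℕ → Set X, Antitone S ∧ (∀ n, S n - S n ⊆ A n) ∧
      ∀ n, ∀ F ∈ 𝓕, (S n ∩ π ⁻¹' F).Nonempty := by
  obtain ⟨U, hU, hUA, hUneg, hUadd⟩ := exists_nhds_zero_seq_add_subset hA
  have hUanti : ∀ n, U (n + 1) ⊆ U n := fun n =>
    (subset_add_left _ (mem_of_mem_nhds (hU _))).trans (hUadd n)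
  have hUsub : ∀ n, U (n + 1) - U (n + 1) ⊆ U n := fun n => by
    rw [sub_eq_add_neg, hUneg]
    exact hUadd n
  obtain ⟨F, x, hF, hFU, hxF, hxU⟩ := exists_seq_sub_mem_map_mem hπ h𝓕 hU
  refine ⟨fun n => x (n + 2) +ᵥ U (n + 1), antitone_nat_of_succ_le fun n => ?_,
    fun n => sub_subset_iff.2 ?_, fun n C hC => ?_⟩
  · rintro _ ⟨u, hu, rfl⟩
    exact ⟨_, hUadd _ (add_mem_add (hxU (n + 2)) hu), by simp [← add_assoc]⟩
  · rintro _ ⟨u, hu, rfl⟩ _ ⟨u', hu', rfl⟩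
    simpa only [vadd_eq_add, add_sub_add_left_eq_sub] using hUA n (hUsub n (sub_mem_sub hu hu'))
  · obtain ⟨y, hyC, hyF⟩ := h𝓕.1.nonempty_of_mem (inter_mem hC (hF (n + 2)))
    obtain ⟨u, hu, hπu⟩ := hFU _ (sub_mem_sub hyF (hxF _))
    exact ⟨_, vadd_mem_vadd_set (hUanti _ hu), by simpa [hπu] using hyC⟩

variable [UniformSpace X] [IsUniformAddGroup X]

theorem cauchy_of_sub_subset_add {U : Ultrafilter X} {K : Set X} (hK : IsCompact K)
    (h : ∀ V ∈ 𝓝 (0 : X), ∃ A ∈ U, A - A ⊆ K + V) : Cauchy (U : Filter X) := by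
  refine cauchy_iff_exists_sub_subset.2 ⟨U.neBot, fun N hN => ?_⟩
  obtain ⟨V, hV, -, hVneg, hVN⟩ := exists_closed_nhds_zero_neg_eq_add_subset hN
  replace hVN : V - V ⊆ N := by rwa [sub_eq_add_neg, hVneg]
  obtain ⟨W, hW, -, -, hWV⟩ := exists_closed_nhds_zero_neg_eq_add_subset hV
  obtain ⟨A, hA, hAK⟩ := h W hW
  obtain ⟨a, ha⟩ := U.nonempty_of_mem hA
  obtain ⟨t, -, ht⟩ := hK.elim_nhds_subcover (· +ᵥ W) fun k _ => by
    simpa using vadd_mem_nhds_vadd k hW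
  -- `A` is covered by finitely many small sets, and the ultrafilter contains one of them.
  have hcover : ⋃ k ∈ (t : Set X), (a + k) +ᵥ V ∈ U := by
    refine mem_of_superset hA fun x hx => ?_
    obtain ⟨k, hk, w, hw, hkw⟩ := hAK (sub_mem_sub hx ha)
    obtain ⟨k', hk', w', hw', rfl⟩ := mem_iUnion₂.1 (ht hk)
    refine mem_iUnion₂.2 ⟨k', hk', w' + w, hWV (add_mem_add hw' hw), ?_⟩
    simp only [vadd_eq_add] at hkw ⊢
    rw [add_assoc, ← add_assoc k', hkw, add_sub_cancel]
  obtain ⟨k, -, hk⟩ := (Ultrafilter.finite_biUnion_mem_iff t.finite_toSet).1 hcover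
  refine ⟨_, hk, sub_subset_iff.2 ?_⟩
  rintro _ ⟨v, hv, rfl⟩ _ ⟨v', hv', rfl⟩
  simpa only [vadd_eq_add, add_sub_add_left_eq_sub] using hVN (sub_mem_sub hv hv')

theorem exists_cauchy_ultrafilter_tendsto {H : Type*} [AddGroup H] [TopologicalSpace H]
    [CechCompleteSpace H] {ι : H →+ X} (hι : IsInducing ι) (hπ : IsOpenQuotientMap π)
    (hexact : Function.Exact ι π) {𝓕 : Filter G} (h𝓕 : Cauchy 𝓕) :
    ∃ U : Ultrafilter X, Cauchy (U : Filter X) ∧ Tendsto π U 𝓕 := by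
  obtain ⟨K, hK, A, hA, hKA⟩ := exists_isCompact_range_inter_subset hι
  choose A' hA' hA'sub using fun n => exists_nhds_half_neg (hA n)
  obtain ⟨S, hSanti, hSA, hS⟩ := exists_antitone_seq_inter_preimage_nonempty hπ h𝓕 hA'
  let L : Filter X := ⨅ n, comap π 𝓕 ⊓ 𝓟 (S n)
  have hL : L.NeBot := by
    refine iInf_neBot_of_directed (Antitone.directed_ge fun m n hmn =>
      inf_le_inf_left _ (principal_mono.2 (hSanti hmn))) fun n => ?_
    refine inf_principal_neBot_iff.2 fun T hT => ?_
    obtain ⟨F, hF, hFT⟩ := mem_comap.1 hT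
    exact (hS n F hF).mono fun x hx => ⟨hFT hx.2, hx.1⟩
  have hU : ↑(Ultrafilter.of L) ≤ L := Ultrafilter.of_le L
  have hSU : ∀ n, S n ∈ Ultrafilter.of L := fun n =>
    hU (mem_iInf_of_mem n (mem_inf_of_right (mem_principal_self _)))
  have hlim : Tendsto π (Ultrafilter.of L) 𝓕 :=
    map_le_iff_le_comap.2 (hU.trans ((iInf_le _ 0).trans inf_le_left))
  refine ⟨Ultrafilter.of L, cauchy_of_sub_subset_add hK fun V hV => ?_, hlim⟩
  obtain ⟨W, hW, -, -, hWV⟩ := exists_closed_nhds_zero_neg_eq_add_subset hV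
  obtain ⟨n, hn⟩ := hKA W hW
  obtain ⟨F, hF, hFW⟩ := (cauchy_iff_exists_sub_subset.1 h𝓕).2 (π '' (W ∩ A' n)) (by
    simpa using hπ.isOpenMap.image_mem_nhds (inter_mem hW (hA' n)))
  refine ⟨S n ∩ π ⁻¹' F, inter_mem (hSU n) (hlim hF), sub_subset_iff.2 fun x hx y hy => ?_⟩
  obtain ⟨w, ⟨hwW, hwA⟩, hw⟩ := hFW (sub_mem_sub hx.2 hy.2)
  have hker : x - y - w ∈ range ι := (hexact (x - y - w)).1 (by simp [hw])
  obtain ⟨k, hk, w', hw', hkw⟩ :=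
    hn ⟨hker, hA'sub n _ (hSA n (sub_mem_sub hx.1 hy.1)) _ hwA⟩
  exact ⟨k, hk, w' + w, hWV (add_mem_add hw' hwW), by grind⟩

end Lift

section Completion

/-- The canonical map of a group to its completion, as a continuous homomorphism. -/
noncomputable def completionHom (A : Type*) [AddCommGroup A] [UniformSpace A]
    [IsUniformAddGroup A] : A →ₜ+ Completion A where
  toAddMonoidHom := Completion.toCompl
  continuous_toFun := Completion.continuous_coe A

variable {X G : Type*} [AddCommGroup X] [UniformSpace X] [IsUniformAddGroup X]
  [AddCommGroup G] [UniformSpace G] [IsUniformAddGroup G] {π : X →+ G}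

theorem exists_preimage_completion_subset (hπ : IsOpenMap π) (hπc : Continuous π)
    {V : Set (Completion X)} (hV : V ∈ 𝓝 0) :
    ∃ O ∈ 𝓝 (0 : Completion G),
      π.completion hπc ⁻¹' O ⊆ ((↑) : X → Completion X) '' π.ker + V := by
  obtain ⟨W, hW, -, -, hWV⟩ := exists_closed_nhds_zero_neg_eq_add_subset hV
  have hπW : π '' ((↑) ⁻¹' W : Set X) ∈ 𝓝 (0 : G) := by
    rw [← map_zero π]
    exact hπ.image_mem_nhds ((Completion.continuous_coe X).continuousAt.preimage_mem_nhds
      (by rwa [Completion.coe_zero]))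
  rw [(Completion.isUniformInducing_coe G).isInducing.nhds_eq_comap, Completion.coe_zero] at hπW
  obtain ⟨N, hN, hNW⟩ := mem_comap.1 hπW
  refine ⟨interior N, interior_mem_nhds.2 hN, fun z hz => ?_⟩
  have hzN : π.completion hπc ⁻¹' interior N ∈ 𝓝 z :=
    (AddMonoidHom.continuous_completion π hπc).continuousAt.preimage_mem_nhds
      (isOpen_interior.mem_nhds hz)
  have hzW : (z - ·) ⁻¹' W ∈ 𝓝 z :=
    ContinuousAt.preimage_mem_nhds (f := (z - ·)) (by fun_prop) (by simpa using hW)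
  obtain ⟨_, ⟨hxN, hxW⟩, x, rfl⟩ := mem_closure_iff_nhds.1 (Completion.denseRange_coe z) _
    (inter_mem hzN hzW)
  rw [mem_preimage, AddMonoidHom.completion_coe] at hxN
  obtain ⟨w, hw, hπw⟩ := hNW (interior_subset (s := N) hxN)
  refine ⟨_, mem_image_of_mem _ (x := x - w) (by simp [AddMonoidHom.mem_ker, hπw]), _,
    hWV (add_mem_add hxW hw), ?_⟩
  simp only [Completion.coe_sub]
  abel

end Completion

namespace TopAddExtension

section Completion

variable {G : Type u} {H : Type v} [AddCommGroup H] [TopologicalSpace H] [AddCommGroup G]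

section Topology

variable [TopologicalSpace G] (E : TopAddExtension G H)

instance : UniformSpace E.X :=
  IsTopologicalAddGroup.rightUniformSpace E.X

instance : IsUniformAddGroup E.X :=
  isUniformAddGroup_of_addCommGroup

/-- The inclusion of `H` into the completion of the middle group of `E`. -/
noncomputable def completionι : H →ₜ+ Completion E.X :=
  (completionHom E.X).comp E.ι

theorem isClosedEmbedding_completionι [IsTopologicalAddGroup H] [CechCompleteSpace H] :
    IsClosedEmbedding E.completionι := by
  have := CechCompleteSpace.t35Space (X := H)
  have hind : IsInducing E.completionι :=
    (Completion.isUniformInducing_coe E.X).isInducing.comp E.isEmbedding.isInducing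
  let _ := IsTopologicalAddGroup.rightUniformSpace H
  have := isUniformAddGroup_of_addCommGroup (G := H)
  have := CechCompleteSpace.completeSpace (H := H)
  exact (AddMonoidHom.isUniformEmbedding_of_isEmbedding
    ⟨hind, hind.injective⟩).isClosedEmbedding

end Topology

variable [UniformSpace G] [IsUniformAddGroup G] (E : TopAddExtension G H)

/-- The projection of `E` extended to the completions. -/
noncomputable def completionπ : Completion E.X →ₜ+ Completion G where
  toAddMonoidHom := E.π.toAddMonoidHom.completion E.π.continuous_toFun
  continuous_toFun := AddMonoidHom.continuous_completion _ _

theorem completionπ_coe (x : E.X) : E.completionπ x = E.π x :=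
  AddMonoidHom.completion_coe _ E.π.continuous_toFun x

theorem completionπ_completionι (h : H) : E.completionπ (E.completionι h) = 0 := by
  refine (E.completionπ_coe (E.ι h)).trans ?_
  rw [E.π_ι, Completion.coe_zero]

theorem exists_completionπ_preimage_subset {V : Set (Completion E.X)} (hV : V ∈ 𝓝 0) :
    ∃ O ∈ 𝓝 (0 : Completion G), E.completionπ ⁻¹' O ⊆ range E.completionι + V := by
  obtain ⟨O, hO, hOV⟩ := exists_preimage_completion_subset (π := E.π.toAddMonoidHom)
    E.isOpenQuotientMap.isOpenMap E.π.continuous_toFun hV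
  refine ⟨O, hO, hOV.trans (add_subset_add_right ?_)⟩
  rintro _ ⟨x, hx, rfl⟩
  obtain ⟨h, rfl⟩ := (E.exact x).1 hx
  exact ⟨h, rfl⟩

variable [CechCompleteSpace H]

theorem surjective_completionπ : Function.Surjective E.completionπ := fun g => by
  obtain ⟨U, hU, hUg⟩ := exists_cauchy_ultrafilter_tendsto (ι := E.ι.toAddMonoidHom)
    (π := E.π.toAddMonoidHom) E.isEmbedding.isInducing E.isOpenQuotientMap E.exact
    (cauchy_nhds.comap' (Completion.comap_coe_eq_uniformity G).le
      (Completion.isDenseInducing_coe.comap_nhds_neBot g))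
  obtain ⟨z, hz⟩ := CompleteSpace.complete (hU.map (Completion.uniformContinuous_coe E.X))
  have hπz : Tendsto (fun x : E.X => E.completionπ x) U (𝓝 (E.completionπ z)) :=
    (E.completionπ.continuous_toFun.tendsto z).comp hz
  have hg : Tendsto (fun x : E.X => (E.π x : Completion G)) U (𝓝 g) :=
    (tendsto_comap (f := ((↑) : G → Completion G))).comp hUg
  simp only [completionπ_coe] at hπz
  exact ⟨z, tendsto_nhds_unique hπz hg⟩

theorem isOpenQuotientMap_completionπ : IsOpenQuotientMap E.completionπ := by
  refine ⟨E.surjective_completionπ, E.completionπ.continuous_toFun,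
    IsTopologicalAddGroup.isOpenMap_iff_nhds_zero.2 fun V hV => ?_⟩
  obtain ⟨O, hO, hOV⟩ := E.exists_completionπ_preimage_subset (mem_map.1 hV)
  filter_upwards [hO] with g hg
  obtain ⟨z, rfl⟩ := E.surjective_completionπ g
  obtain ⟨_, ⟨h, rfl⟩, v, hv, rfl⟩ := hOV hg
  simpa [completionπ_completionι] using hv

variable [IsTopologicalAddGroup H]

theorem exact_completion : Function.Exact E.completionι E.completionπ := fun z => by
  refine ⟨fun hz => ?_, ?_⟩
  · refine E.isClosedEmbedding_completionι.isClosed_range.closure_subset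
      (mem_closure_iff_nhds_zero.2 fun V hV => ?_)
    obtain ⟨O, hO, hOV⟩ := E.exists_completionπ_preimage_subset (neg_mem_nhds_zero _ hV)
    obtain ⟨y, hy, v, hv, rfl⟩ := hOV (show E.completionπ z ∈ O from hz ▸ mem_of_mem_nhds hO)
    exact ⟨y, hy, by simpa using hv⟩
  · rintro ⟨h, rfl⟩
    exact E.completionπ_completionι h

/-- The extension of the completion of `G` by `H` whose middle group is the completion of that
of `E`. -/
noncomputable def completion : TopAddExtension (Completion G) H where
  X := Completion E.X
  ι := E.completionι
  π := E.completionπ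
  isEmbedding := E.isClosedEmbedding_completionι.isEmbedding
  isOpenQuotientMap := E.isOpenQuotientMap_completionπ
  exact := E.exact_completion

end Completion

end TopAddExtension

theorem exists_continuousAddMonoidHom_extend {A B Z : Type*} [AddCommGroup A] [TopologicalSpace A]
    [IsTopologicalAddGroup A] [AddCommGroup B] [TopologicalSpace B] [IsTopologicalAddGroup B]
    [AddCommGroup Z] [UniformSpace Z] [IsUniformAddGroup Z] [CompleteSpace Z] [T2Space Z]
    {i : A →ₜ+ B} (hi : IsDenseInducing i) (f : A →ₜ+ Z) : ∃ F : B →ₜ+ Z, ∀ a, F (i a) = f a := by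
  let _ := IsTopologicalAddGroup.rightUniformSpace A
  let _ := IsTopologicalAddGroup.rightUniformSpace B
  have := isUniformAddGroup_of_addCommGroup (G := A)
  have := isUniformAddGroup_of_addCommGroup (G := B)
  have hui : IsUniformInducing i :=
    AddMonoidHom.isUniformInducing_of_isInducing (f := i.toAddMonoidHom) hi.isInducing
  have hf : UniformContinuous f :=
    uniformContinuous_addMonoidHom_of_continuous (f := f.toAddMonoidHom) f.continuous_toFun
  have hext : Continuous (hi.extend f) :=
    (uniformContinuous_uniformly_extend hui hi.dense hf).continuous
  have hexti : ∀ a, hi.extend f (i a) = f a := hi.extend_eq hf.continuous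
  refine ⟨⟨⟨⟨hi.extend f, ?_⟩, fun b c => ?_⟩, hext⟩, hexti⟩
  · rw [← map_zero i, hexti, map_zero]
  · refine hi.dense.induction_on₂ (p := fun b c => hi.extend f (b + c) = hi.extend f b +
      hi.extend f c) (isClosed_eq (by fun_prop) (by fun_prop)) (fun b c => ?_) b c
    rw [← map_add, hexti, hexti, hexti, map_add]

namespace TopAddExtension

variable {G G' : Type u} {H : Type v} [AddCommGroup G] [TopologicalSpace G]
  [AddCommGroup G'] [TopologicalSpace G'] [IsTopologicalAddGroup G']
  [AddCommGroup H] [TopologicalSpace H] {E F : TopAddExtension G H} {t : G' →ₜ+ G}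

section Pullback

variable (E t) in
/-- The canonical map from the middle group of the pullback of `E` along `t` to that of `E`. -/
def pullbackFst : (E.pullback t).X →ₜ+ E.X where
  toFun p := p.1.1
  map_zero' := rfl
  map_add' _ _ := rfl
  continuous_toFun := continuous_fst.comp continuous_subtype_val

theorem π_pullbackFst (p : (E.pullback t).X) :
    E.π (E.pullbackFst t p) = t ((E.pullback t).π p) :=
  p.2

/-- The universal property of the pullback: the map with components `f` and `g`. -/
def pullbackLift {A : Type*} [AddCommGroup A] [TopologicalSpace A] (f : A →ₜ+ E.X) (g : A →ₜ+ G')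
    (h : ∀ a, E.π (f a) = t (g a)) : A →ₜ+ (E.pullback t).X where
  toFun a := ⟨(f a, g a), h a⟩
  map_zero' := Subtype.ext (Prod.ext (map_zero f) (map_zero g))
  map_add' a b := Subtype.ext (Prod.ext (map_add f a b) (map_add g a b))
  continuous_toFun := (f.continuous_toFun.prodMk g.continuous_toFun).subtype_mk _

theorem equivalent_pullback {F : TopAddExtension G' H} (f : F.X →ₜ+ E.X)
    (hι : ∀ h, f (F.ι h) = E.ι h) (hπ : ∀ x, E.π (f x) = t (F.π x)) :
    Equivalent F (E.pullback t) :=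
  ⟨pullbackLift f F.π hπ, fun h => Subtype.ext (Prod.ext (hι h) (F.π_ι h)), fun _ => rfl⟩

theorem pullback_congr (h : Equivalent E F) : Equivalent (E.pullback t) (F.pullback t) := by
  obtain ⟨T, hTι, hTπ⟩ := h
  exact equivalent_pullback (T.comp (E.pullbackFst t)) hTι fun p => (hTπ _).trans p.2

theorem isDenseInducing_pullbackFst (ht : IsDenseInducing t) :
    IsDenseInducing (E.pullbackFst t) := by
  refine ⟨.of_comp (E.pullbackFst t).continuous_toFun
    (continuous_id.prodMk E.π.continuous_toFun) ?_, ?_⟩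
  · have h := (IsInducing.id.prodMap ht.isInducing).comp
      (IsInducing.subtypeVal (t := (E.pullbackGroup t : Set (E.X × G'))))
    have he : (fun x => (id x, E.π x)) ∘ E.pullbackFst t = Prod.map id t ∘ Subtype.val :=
      funext fun p => Prod.ext rfl (π_pullbackFst p)
    exact he ▸ h
  · have hrange : range (E.pullbackFst t) = E.π ⁻¹' range t := by
      ext x
      refine ⟨?_, fun ⟨g, hg⟩ => ⟨⟨(x, g), hg.symm⟩, rfl⟩⟩
      rintro ⟨p, rfl⟩
      exact ⟨_, (π_pullbackFst p).symm⟩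
    rw [DenseRange, hrange]
    exact ht.dense.preimage E.isOpenQuotientMap.isOpenMap

theorem pullback_baerSum [IsTopologicalAddGroup G] [IsTopologicalAddGroup H] :
    Equivalent ((E.pullback t).baerSum (F.pullback t)) ((E.baerSum F).pullback t) := by
  let e := (E.pullbackFst t).comp (diagFst (E.pullback t) (F.pullback t))
  let f := (F.pullbackFst t).comp (diagSnd (E.pullback t) (F.pullback t))
  have he : ∀ p, E.π (e p) = t (((E.pullback t).diagProd (F.pullback t)).π p) := fun p =>
    (π_pullbackFst _).trans (congrArg t (π_diagFst _ _ p))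
  have hf : ∀ p, F.π (f p) = t (((E.pullback t).diagProd (F.pullback t)).π p) := fun p =>
    (π_pullbackFst _).trans (congrArg t (π_diagSnd _ _ p))
  let S := liftBaerSum E F e f fun p => (hf p).trans (he p).symm
  have hS : ∀ p, (E.baerSum F).π (S p) = t (((E.pullback t).diagProd (F.pullback t)).π p) := he
  refine baerSum_equivalent _ _ _ (pullbackLift S _ hS) (fun h => ?_) fun _ => rfl
  exact Subtype.ext (Prod.ext (liftBaerSum_ι E F e f _ _ h.1 h.2 rfl rfl)
    (((E.pullback t).diagProd (F.pullback t)).π_ι h))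

end Pullback

variable [IsTopologicalAddGroup G] [IsTopologicalAddGroup H] [CechCompleteSpace H]

theorem equivalent_of_pullback (ht : IsDenseInducing t)
    (h : Equivalent (E.pullback t) (F.pullback t)) : Equivalent E F := by
  let _ := IsTopologicalAddGroup.rightUniformSpace G
  have := isUniformAddGroup_of_addCommGroup (G := G)
  obtain ⟨T, hTι, hTπ⟩ := h
  obtain ⟨f, hf⟩ := exists_continuousAddMonoidHom_extend
    (E.isDenseInducing_pullbackFst ht) (((completionHom F.X).comp (F.pullbackFst t)).comp T)
  have hfι : ∀ h, f (E.ι h) = F.completionι h := fun h =>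
    (hf ((E.pullback t).ι h)).trans (congrArg ((completionHom F.X).comp (F.pullbackFst t)) (hTι h))
  have hfπ : ∀ x, F.completionπ (f x) = completionHom G (E.π x) := fun x => by
    refine (E.isDenseInducing_pullbackFst ht).dense.induction_on
      (p := fun x => F.completionπ (f x) = completionHom G (E.π x)) x
      (isClosed_eq (F.completionπ.comp f).continuous_toFun
        ((completionHom G).comp E.π).continuous_toFun) fun p => ?_
    rw [hf, π_pullbackFst, ← hTπ, ← π_pullbackFst]
    exact F.completionπ_coe _
  have hE : Equivalent E (F.completion.pullback (completionHom G)) := equivalent_pullback f hfι hfπ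
  have hF : Equivalent F (F.completion.pullback (completionHom G)) :=
    equivalent_pullback (completionHom F.X) (fun _ => rfl) F.completionπ_coe
  exact hE.trans hF.symm

theorem exists_equivalent_pullback (ht : IsDenseInducing t) (E : TopAddExtension G' H) :
    ∃ F : TopAddExtension G H, Equivalent E (F.pullback t) := by
  let _ := IsTopologicalAddGroup.rightUniformSpace G'
  have := isUniformAddGroup_of_addCommGroup (G := G')
  obtain ⟨s, hs⟩ := exists_continuousAddMonoidHom_extend ht (completionHom G')
  have hπ : ∀ x, E.completion.π (completionHom E.X x) = s (t (E.π x)) := fun x =>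
    (E.completionπ_coe x).trans (hs (E.π x)).symm
  refine ⟨E.completion.pullback s, equivalent_pullback
    (pullbackLift (completionHom E.X) (t.comp E.π) hπ) (fun h => ?_) fun _ => rfl⟩
  exact Subtype.ext (Prod.ext rfl ((congrArg t (E.π_ι h)).trans (map_zero t)))

end TopAddExtension

/-- The homomorphism `Ext(G, H) → Ext(G', H)` induced by `t : G' → G`. -/
def TopExt.pullback {G G' : Type u} {H : Type v} [AddCommGroup G] [TopologicalSpace G]
    [IsTopologicalAddGroup G] [AddCommGroup G'] [TopologicalSpace G'] [IsTopologicalAddGroup G']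
    [AddCommGroup H] [TopologicalSpace H] [IsTopologicalAddGroup H] (t : G' →ₜ+ G) :
    TopExt G H →+ TopExt G' H :=
  AddMonoidHom.mk' (Quotient.map (·.pullback t) fun _ _ => TopAddExtension.pullback_congr) <| by
    rintro ⟨E⟩ ⟨F⟩
    exact Quotient.sound TopAddExtension.pullback_baerSum.symm

theorem theorem3p3_general {G G' : Type u} {H : Type v} [AddCommGroup G] [TopologicalSpace G]
    [IsTopologicalAddGroup G] [AddCommGroup G'] [TopologicalSpace G'] [IsTopologicalAddGroup G']
    [AddCommGroup H] [TopologicalSpace H] [IsTopologicalAddGroup H] [CechCompleteSpace H]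
    {t : G' →ₜ+ G} (ht : IsDenseInducing t) :
    Function.Bijective (TopExt.pullback t : TopExt G H →+ TopExt G' H) := by
  constructor
  · rintro ⟨E⟩ ⟨F⟩ h
    exact Quotient.sound (TopAddExtension.equivalent_of_pullback ht (Quotient.exact h))
  · rintro ⟨E⟩
    obtain ⟨F, hF⟩ := TopAddExtension.exists_equivalent_pullback ht E
    exact ⟨⟦F⟧, (Quotient.sound hF).symm⟩

theorem theorem3p3 {G : Type u} {H : Type v}
    [AddCommGroup G] [TopologicalSpace G] [IsTopologicalAddGroup G] [T2Space G]
    [AddCommGroup H] [TopologicalSpace H] [IsTopologicalAddGroup H] [T2Space H]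
    [CechCompleteSpace H] (D : AddSubgroup G) (hD : Dense (D : Set G)) :
    Nonempty (TopExt G H ≃+ TopExt D H) :=
  ⟨.ofBijective _ (theorem3p3_general (t := ⟨D.subtype, continuous_subtype_val⟩)
    ⟨.subtypeVal, hD.denseRange_val⟩)⟩
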